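/- **Theorem 5.6.** Let $(\Omega,\mu)$ be a $\sigma$-finite measure space with non-atomic measure $\mu$. Functions on $\Omega$ are (real- or complex-valued) measurable functions modulo equality a.e.; $f^*(t)=\inf\{\lambda\ge 0:\mu\{|f|>\lambda\}\le t\}$ is the non-increasing rearrangement of $f$, and $\|\cdot\|_{q,(\alpha,\beta)}$ is the (quasi-)norm of the Lebesgue space $L_q(\alpha,\beta)$. Throughout $1/\infty=0$ and $1/0=\infty$. A Lebesgue measurable $b:(0,\infty)\to(0,\infty)$ is *slowly varying* ($b\in SV$) if for every $\varepsilon>0$ the function $t^{\varepsilon}b(t)$ is equivalent, up to constant factors, to a non-decreasing function and $t^{-\varepsilon}b(t)$ to a non-increasing one. Let $0<\theta\le1$, $0<\varkappa<\infty$, $p=\frac{\varkappa}{1-\theta}$ (so $p=\infty$ if $\theta=1$), $0<q,r,s\le\infty$, and $a,b,c\in SV$ with $$\big\|u^{-1/r}b(u)\big\|_{r,(1,\infty)}<\infty .$$ Put $\tilde a(t)=a(t^{1/\varkappa})$, and similarly $\tilde b,\tilde c$. For a couple $(A_0,A_1)$ of quasi-normed spaces of measurable functions on $\Omega$ let $K(t,f)=\inf\{\|f_0\|_{A_0}+t\|f_1\|_{A_1}: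 f=f_0+f_1,\ f_i\in A_i\}$, and let $(A_0,A_1)^{\mathcal L,\mathcal R}_{\theta,s,c,r,b,q,a}$ be the space of all $f\in A_0+A_1$ for which $$\bigg\|t^{-\frac1s}c(t)\Big\|u^{-\frac1r}b(u)\big\|v^{-\theta-\frac1q}a(v)K(v,f)\big\|_{q,(t,u)}\Big\|_{r,(t,\infty)}\bigg\|_{s,(0,\infty)}<\infty ,$$ quasi-normed by this expression. Let $L^{\mathcal L,\mathcal R}_{p,(s,\tilde c,r,\tilde b,q,\tilde a)}$ be the space of all measurable $f$ for which $$\bigg\|t^{-\frac1s}\tilde c(t)\Big\|u^{-\frac1r}\tilde b(u)\big\|v^{\frac1p-\frac1q}\tilde a(v)f^*(v)\big\|_{q,(t,u)}\Big\|_{r,(t,\infty)}\bigg\|_{s,(0,\infty)}<\infty ,$$ quasi-normed by this expression. Let $L_\varkappa$ and $L_\infty$ be the Lebesgue spaces on $\Omega$, and let $L_{\varkappa,\infty}$ be the weak Lebesgue space with quasi-norm $\sup_{t>0}t^{1/\varkappa}f^*(t)$. Then $$(L_\varkappa,L_\infty)^{\mathcal L,\mathcal R}_{\theta,s,c,r,b,q,a}=(L_{\varkappa,\infty},L_\infty)^{\mathcal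 L,\mathcal R}_{\theta,s,c,r,b,q,a}=L^{\mathcal L,\mathcal R}_{p,(s,\tilde c,r,\tilde b,q,\tilde a)},$$ in the sense that these spaces consist of the same functions and their quasi-norms are equivalent. -/

import Mathlib

open MeasureTheory Set
open scoped ENNReal

/-- A measure is non-atomic: every measurable set of positive measure has a measurable
subset of strictly smaller positive measure. -/
def IsNonatomicMeasure {Ω : Type*} [MeasurableSpace Ω] (μ : Measure Ω) : Prop :=
  ∀ A : Set Ω, MeasurableSet A → 0 < μ A →
    ∃ B : Set Ω, B ⊆ A ∧ MeasurableSet B ∧ 0 < μ B ∧ μ B < μ A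

/-- Two functions are equivalent on `(0, ∞)`: each is bounded by a constant times the other. -/
def EquivOnPos (f g : ℝ → ℝ) : Prop :=
  ∃ C : ℝ, 0 < C ∧ ∀ t : ℝ, 0 < t → f t ≤ C * g t ∧ g t ≤ C * f t

/-- Slowly varying functions on `(0, ∞)`. Only the values on `(0, ∞)` matter. -/
structure IsSlowlyVarying (b : ℝ → ℝ) : Prop where
  /-- Lebesgue measurability on `(0, ∞)`. -/
  measurable : AEMeasurable b (volume.restrict (Ioi 0))
  pos : ∀ t : ℝ, 0 < t → 0 < b t
  increasing : ∀ ε : ℝ, 0 < ε →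
    ∃ g : ℝ → ℝ, MonotoneOn g (Ioi 0) ∧ EquivOnPos (fun t => t ^ ε * b t) g
  decreasing : ∀ ε : ℝ, 0 < ε →
    ∃ g : ℝ → ℝ, AntitoneOn g (Ioi 0) ∧ EquivOnPos (fun t => t ^ (-ε) * b t) g

/-- The rescaled function `u ↦ b (u ^ (1 / κ))`. -/
noncomputable def rescale (κ : ℝ) (b : ℝ → ℝ) : ℝ → ℝ := fun u => b (u ^ (1 / κ))

/-- The (quasi-)norm of the Lebesgue space `L_q` on the subset `I` of the line, for
functions with values in `[0, ∞]`. -/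
noncomputable def normOn (q : ℝ≥0∞) (I : Set ℝ) (g : ℝ → ℝ≥0∞) : ℝ≥0∞ :=
  eLpNorm g q (volume.restrict I)

/-- The weight `t ↦ t ^ (α - 1 / q) * b t`, where `1 / ∞ = 0`. -/
noncomputable def weight (α : ℝ) (q : ℝ≥0∞) (b : ℝ → ℝ) (t : ℝ) : ℝ≥0∞ :=
  ENNReal.ofReal (t ^ (α - (1 / q).toReal) * b t)

/-- The iterated quasi-norm
`‖ t^(-1/s) c(t) ‖ u^(-1/r) b(u) ‖ v^(α-1/q) a(v) g(v) ‖_{q,(t,u)} ‖_{r,(t,∞)} ‖_{s,(0,∞)}`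
of a function `g` on `(0, ∞)`. -/
noncomputable def iteratedNormLR (α : ℝ) (s : ℝ≥0∞) (c : ℝ → ℝ) (r : ℝ≥0∞) (b : ℝ → ℝ)
    (q : ℝ≥0∞) (a : ℝ → ℝ) (g : ℝ → ℝ≥0∞) : ℝ≥0∞ :=
  normOn s (Ioi 0) fun t => weight 0 s c t *
    normOn r (Ioi t) fun u => weight 0 r b u *
      normOn q (Ioo t u) fun v => weight α q a v * g v

/-- The non-increasing rearrangement
`f^*(t) = inf {l ≥ 0 : μ {|f| > l} ≤ t}` (with `inf ∅ = ∞`). -/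
noncomputable def rearrangement {Ω 𝕜 : Type*} [MeasurableSpace Ω] [RCLike 𝕜] {μ : Measure Ω}
    (f : Ω →ₘ[μ] 𝕜) (t : ℝ) : ℝ≥0∞ :=
  sInf {l : ℝ≥0∞ | μ {x | l < ‖f x‖ₑ} ≤ ENNReal.ofReal t}

/-- A space of measurable functions (modulo equality almost everywhere), together with its
quasi-norm. The quasi-norm is recorded as a functional on all measurable functions, but only its
values on the space matter. This only packages data; all spaces below are explicit. -/
structure FunctionSpace {Ω : Type*} [MeasurableSpace Ω] (μ : Measure Ω)
    (𝕜 : Type*) [RCLike 𝕜] where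
  carrier : Set (Ω →ₘ[μ] 𝕜)
  qnorm : (Ω →ₘ[μ] 𝕜) → ℝ≥0∞

namespace FunctionSpace

variable {Ω : Type*} [MeasurableSpace Ω] {μ : Measure Ω} {𝕜 : Type*} [RCLike 𝕜]

/-- The space of all measurable functions at which the functional `N` is finite. -/
def ofQNorm (N : (Ω →ₘ[μ] 𝕜) → ℝ≥0∞) : FunctionSpace μ 𝕜 where
  carrier := {f | N f < ∞}
  qnorm := N

/-- Continuous embedding `X ⊂ Y`. -/
def Embeds (X Y : FunctionSpace μ 𝕜) : Prop :=
  X.carrier ⊆ Y.carrier ∧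
    ∃ C : ℝ, 0 < C ∧ ∀ f ∈ X.carrier, Y.qnorm f ≤ ENNReal.ofReal C * X.qnorm f

/-- `X = Y` as function spaces: the same functions and equivalent quasi-norms. -/
def Same (X Y : FunctionSpace μ 𝕜) : Prop := X.Embeds Y ∧ Y.Embeds X

/-- The algebraic sum `X + Y`. -/
def sumSet (X Y : FunctionSpace μ 𝕜) : Set (Ω →ₘ[μ] 𝕜) :=
  {f | ∃ g ∈ X.carrier, ∃ h ∈ Y.carrier, f = g + h}

/-- Peetre's `K`-functional `K(t, f; X, Y)`. -/
noncomputable def kFunctional (X Y : FunctionSpace μ 𝕜) (t : ℝ) (f : Ω →ₘ[μ] 𝕜) : ℝ≥0∞ :=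
  ⨅ (g ∈ X.carrier) (h ∈ Y.carrier) (_ : f = g + h), X.qnorm g + ENNReal.ofReal t * Y.qnorm h

/-- The `𝓛𝓡` extremal interpolation space `(X, Y)^{𝓛,𝓡}_{θ,s,c,r,b,q,a}`. -/
noncomputable def interpolationLR (X Y : FunctionSpace μ 𝕜) (θ : ℝ) (s : ℝ≥0∞) (c : ℝ → ℝ)
    (r : ℝ≥0∞) (b : ℝ → ℝ) (q : ℝ≥0∞) (a : ℝ → ℝ) : FunctionSpace μ 𝕜 where
  carrier := {f | f ∈ sumSet X Y ∧
    iteratedNormLR (-θ) s c r b q a (fun v => kFunctional X Y v f) < ∞}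
  qnorm := fun f => iteratedNormLR (-θ) s c r b q a (fun v => kFunctional X Y v f)

variable (μ 𝕜)

/-- The Lebesgue space `L_p`. -/
noncomputable def lebesgue (p : ℝ≥0∞) : FunctionSpace μ 𝕜 :=
  ofQNorm fun f => eLpNorm f p μ

/-- The weak Lebesgue space `L_{κ,∞}`, with quasi-norm `sup_{t > 0} t^(1/κ) f^*(t)`. -/
noncomputable def weakLebesgue (κ : ℝ) : FunctionSpace μ 𝕜 :=
  ofQNorm fun f => ⨆ (t : ℝ) (_ : 0 < t), ENNReal.ofReal (t ^ (1 / κ)) * rearrangement f t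

/-- The `𝓛𝓡` Lorentz–Karamata space `L^{𝓛,𝓡}_{p,(s,c,r,b,q,a)}`. -/
noncomputable def lorentzKaramataLR (p s : ℝ≥0∞) (c : ℝ → ℝ) (r : ℝ≥0∞) (b : ℝ → ℝ)
    (q : ℝ≥0∞) (a : ℝ → ℝ) : FunctionSpace μ 𝕜 :=
  ofQNorm fun f => iteratedNormLR (1 / p).toReal s c r b q a (rearrangement f)

end FunctionSpace

/-! Everything is compared with the single function $G(v)=v f^*(v^\varkappa)$. From below, $G(v)\le
K(v,f;L_{\varkappa,\infty},L_\infty)$ (`mul_rearrangement_le_kFunctional`). From above, cutting $f$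
at height $f^*(v^\varkappa)$ gives $K(v,f;L_\varkappa,L_\infty)\le 3\big(\sum_{j\ge0}
G(2^{-j}v)^\varkappa\big)^{1/\varkappa}$ (`kFunctional_lebesgue_le`), the sum being a discrete form
of Holmstedt's integral. The substitution $v=w^{1/\varkappa}$ turns the iterated quasi-norm of $G$
into a constant multiple of the Lorentz–Karamata one (`exists_iteratedNormLR_rearrangement_eq`).

It remains to absorb the sum over $j$ (`exists_iteratedNormLR_dyadic_le`). For
$\rho\le\min(\varkappa,q,r,s)$ the $\ell^\varkappa$ sum is dominated by the $\ell^\rho$ sum, and the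
iterated quasi-norm obeys the $\rho$-triangle inequality. All intervals scale together, so passing
to $G(2^{-j}\cdot)$ costs only $C2^{j(-\theta+\varepsilon)}$, the $\varepsilon$ coming from slow
variation. As $\theta>0$, $\varepsilon=\theta/2$ gives a convergent geometric series.

With the trivial embedding from $L_\varkappa\subset L_{\varkappa,\infty}$, this yields a cycle of
three embeddings. -/

/-! ### Quasi-norms on subsets of the line and the `ρ`-triangle inequality. -/

section NormOn

variable {q : ℝ≥0∞} {I : Set ℝ}

theorem normOn_top (F : ℝ → ℝ≥0∞) : normOn ∞ I F = essSup F (volume.restrict I) := by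
  simp [normOn, eLpNorm_exponent_top, eLpNormEssSup]

theorem normOn_eq_lintegral (hq : q ≠ 0) (hq' : q ≠ ∞) (F : ℝ → ℝ≥0∞) :
    normOn q I F = (∫⁻ x in I, F x ^ q.toReal) ^ (1 / q.toReal) := by
  simp [normOn, eLpNorm_eq_lintegral_rpow_enorm_toReal hq hq']

theorem normOn_mono_ae {F G : ℝ → ℝ≥0∞} (h : ∀ᵐ x ∂volume.restrict I, F x ≤ G x) :
    normOn q I F ≤ normOn q I G :=
  eLpNorm_mono_enorm_ae (by simpa using h)

theorem normOn_mono {F G : ℝ → ℝ≥0∞} (hI : MeasurableSet I) (h : ∀ x ∈ I, F x ≤ G x) :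
    normOn q I F ≤ normOn q I G :=
  normOn_mono_ae (ae_restrict_of_forall_mem hI h)

theorem normOn_congr {F G : ℝ → ℝ≥0∞} (hI : MeasurableSet I) (h : ∀ x ∈ I, F x = G x) :
    normOn q I F = normOn q I G :=
  le_antisymm (normOn_mono hI fun x hx => (h x hx).le) (normOn_mono hI fun x hx => (h x hx).ge)

theorem normOn_mono_set {J : Set ℝ} (h : I ⊆ J) (F : ℝ → ℝ≥0∞) :
    normOn q I F ≤ normOn q J F :=
  eLpNorm_mono_measure _ (Measure.restrict_mono h le_rfl)

theorem normOn_const_mul {C : ℝ≥0∞} (hC : C ≠ ∞) (F : ℝ → ℝ≥0∞) :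
    normOn q I (fun x => C * F x) = C * normOn q I F := by
  rcases eq_or_ne q 0 with rfl | hq
  · simp [normOn]
  rcases eq_or_ne q ∞ with rfl | hq'
  · rw [normOn_top, normOn_top, ENNReal.essSup_const_mul]
  have hp : 0 < q.toReal := ENNReal.toReal_pos hq hq'
  rw [normOn_eq_lintegral hq hq', normOn_eq_lintegral hq hq']
  simp_rw [ENNReal.mul_rpow_of_nonneg _ _ hp.le]
  rw [lintegral_const_mul' _ _ (by simp [hC, hp.le]),
    ENNReal.mul_rpow_of_nonneg _ _ (by positivity), ← ENNReal.rpow_mul,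
    mul_one_div_cancel hp.ne', ENNReal.rpow_one]

/-- Minkowski's inequality for countable sums. -/
theorem normOn_tsum_le (hq : 1 ≤ q) {F : ℕ → ℝ → ℝ≥0∞}
    (hF : ∀ j, AEMeasurable (F j) (volume.restrict I)) :
    normOn q I (fun x => ∑' j, F j x) ≤ ∑' j, normOn q I (F j) := by
  have hsum (n : ℕ) : normOn q I (fun x => ∑ j ∈ Finset.range n, F j x) ≤
      ∑' j, normOn q I (F j) := by
    refine le_trans ?_ (ENNReal.sum_le_tsum (Finset.range n))
    have := eLpNorm_sum_le (s := Finset.range n) (f := F) (p := q)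
      (fun j _ => (hF j).aestronglyMeasurable) hq
    rwa [show ∑ j ∈ Finset.range n, F j = fun x => ∑ j ∈ Finset.range n, F j x from
      funext fun x => Finset.sum_apply x _ _] at this
  rcases eq_or_ne q ∞ with rfl | hq'
  · simp only [normOn_top] at hsum ⊢
    have h (n : ℕ) : ∀ᵐ x ∂volume.restrict I, ∑ j ∈ Finset.range n, F j x ≤
        ∑' j, essSup (F j) (volume.restrict I) := by
      filter_upwards [ENNReal.ae_le_essSup
        (μ := volume.restrict I) (fun x => ∑ j ∈ Finset.range n, F j x)] with x hx
      exact hx.trans (hsum n)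
    refine essSup_le_of_ae_le _ ?_
    filter_upwards [ae_all_iff.2 h] with x hx
    rw [ENNReal.tsum_eq_iSup_nat]
    exact iSup_le hx
  have hq0 : q ≠ 0 := (zero_lt_one.trans_le hq).ne'
  have hp : 0 < q.toReal := ENNReal.toReal_pos hq0 hq'
  simp only [normOn_eq_lintegral hq0 hq', one_div] at hsum ⊢
  simp_rw [ENNReal.rpow_inv_le_iff hp] at hsum ⊢
  have hsup (x : ℝ) : (∑' j, F j x) ^ q.toReal =
      ⨆ n : ℕ, (∑ j ∈ Finset.range n, F j x) ^ q.toReal := by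
    rw [ENNReal.tsum_eq_iSup_nat]
    exact (ENNReal.orderIsoRpow _ hp).map_iSup _
  simp_rw [hsup]
  rw [lintegral_iSup']
  · exact iSup_le hsum
  · intro n
    exact (Finset.aemeasurable_fun_sum _ fun j _ => hF j).pow_const _
  · filter_upwards with x m n hmn
    exact ENNReal.rpow_le_rpow (Finset.sum_le_sum_of_subset (Finset.range_mono hmn)) hp.le

theorem normOn_rpow {ρ : ℝ} (hρ : 0 < ρ) (F : ℝ → ℝ≥0∞) :
    normOn q I (fun x => F x ^ ρ) = normOn (q * ENNReal.ofReal ρ) I F ^ ρ := by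
  simpa [normOn] using eLpNorm_enorm_rpow (p := q) (μ := volume.restrict I) F hρ

/-- The `ρ`-triangle inequality in `L_q` for `ρ ≤ q`, for countable sums. -/
theorem normOn_rpow_tsum_le {ρ : ℝ} (hρ : 0 < ρ) (hq : ENNReal.ofReal ρ ≤ q)
    {F : ℕ → ℝ → ℝ≥0∞} (hF : ∀ j, AEMeasurable (F j) (volume.restrict I)) :
    normOn q I (fun x => (∑' j, F j x ^ ρ) ^ ρ⁻¹) ≤ (∑' j, normOn q I (F j) ^ ρ) ^ ρ⁻¹ := by
  have h0 : ENNReal.ofReal ρ ≠ 0 := by simpa using hρ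
  -- The exponent `q / ρ` is at least `1`, so Minkowski applies to the `ρ`-th powers.
  have hqρ : q / ENNReal.ofReal ρ * ENNReal.ofReal ρ = q :=
    ENNReal.div_mul_cancel h0 ENNReal.ofReal_ne_top
  have h1 : 1 ≤ q / ENNReal.ofReal ρ := by
    rw [ENNReal.le_div_iff_mul_le (Or.inl h0) (Or.inl ENNReal.ofReal_ne_top), one_mul]
    exact hq
  have h := normOn_tsum_le (I := I) h1 (F := fun j x => F j x ^ ρ)
    fun j => (hF j).pow_const _
  simp only [normOn_rpow hρ, hqρ] at h
  rw [ENNReal.le_rpow_inv_iff hρ]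
  refine le_trans (le_of_eq ?_) h
  conv_lhs => rw [← hqρ, ← normOn_rpow hρ]
  simp only [ENNReal.rpow_inv_rpow hρ.ne']

end NormOn

/-! ### The substitution `y = l * x ^ m` in weighted quasi-norms. -/

section ChangeOfVariables

variable {l m : ℝ}

theorem mul_rpow_pos (hl : 0 < l) {x : ℝ} (hx : 0 < x) : 0 < l * x ^ m := by positivity

theorem strictMonoOn_mul_rpow (hl : 0 < l) (hm : 0 < m) :
    StrictMonoOn (fun x : ℝ => l * x ^ m) (Ici 0) := fun x hx y _ hxy => by
  have := Real.rpow_lt_rpow hx hxy hm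
  dsimp only
  gcongr

theorem inverse_mul_rpow (hl : 0 < l) (hm : 0 < m) {y : ℝ} (hy : 0 < y) :
    ∃ x, 0 < x ∧ l * x ^ m = y := by
  refine ⟨(y / l) ^ m⁻¹, by positivity, ?_⟩
  rw [Real.rpow_inv_rpow (by positivity) hm.ne']
  field_simp

theorem image_mul_rpow_Ioi (hl : 0 < l) (hm : 0 < m) {t : ℝ} (ht : 0 ≤ t) :
    (fun x : ℝ => l * x ^ m) '' Ioi t = Ioi (l * t ^ m) := by
  have hmono := strictMonoOn_mul_rpow hl hm
  ext y
  constructor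
  · rintro ⟨x, hx, rfl⟩
    exact hmono ht (ht.trans hx.le) hx
  · intro hy
    obtain ⟨x, hx, rfl⟩ := inverse_mul_rpow hl hm
      ((by positivity : 0 ≤ l * t ^ m).trans_lt (mem_Ioi.1 hy))
    exact ⟨x, (hmono.lt_iff_lt ht hx.le).1 hy, rfl⟩

theorem image_mul_rpow_Ioo (hl : 0 < l) (hm : 0 < m) {t u : ℝ} (ht : 0 ≤ t) (hu : 0 ≤ u) :
    (fun x : ℝ => l * x ^ m) '' Ioo t u = Ioo (l * t ^ m) (l * u ^ m) := by
  have hmono := strictMonoOn_mul_rpow hl hm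
  ext y
  constructor
  · rintro ⟨x, hx, rfl⟩
    exact ⟨hmono ht (ht.trans hx.1.le) hx.1, hmono (ht.trans hx.1.le) hu hx.2⟩
  · intro hy
    obtain ⟨x, hx, rfl⟩ := inverse_mul_rpow hl hm
      ((by positivity : 0 ≤ l * t ^ m).trans_lt hy.1)
    exact ⟨x, ⟨(hmono.lt_iff_lt ht hx.le).1 hy.1, (hmono.lt_iff_lt hx.le hu).1 hy.2⟩, rfl⟩

theorem hasDerivAt_mul_rpow {x : ℝ} (hx : 0 < x) :
    HasDerivAt (fun x : ℝ => l * x ^ m) (l * (m * x ^ (m - 1))) x :=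
  (Real.hasDerivAt_rpow_const (Or.inl hx.ne')).const_mul l

/-- Differentiable maps send null sets to null sets. No measurability of `P` is needed, which lets
the case `q = ∞` treat arbitrary functions. -/
theorem ae_image_mul_rpow (hl : 0 < l) (hm : 0 < m) {I : Set ℝ} (hI : MeasurableSet I)
    (hI0 : I ⊆ Ioi 0) {P : ℝ → Prop} (h : ∀ᵐ x ∂volume.restrict I, P (l * x ^ m)) :
    ∀ᵐ y ∂volume.restrict ((fun x : ℝ => l * x ^ m) '' I), P y := by
  have hd : DifferentiableOn ℝ (fun x : ℝ => l * x ^ m) I := fun x hx =>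
    (hasDerivAt_mul_rpow (hI0 hx)).differentiableAt.differentiableWithinAt
  have hinj : InjOn (fun x : ℝ => l * x ^ m) I :=
    (strictMonoOn_mul_rpow hl hm).injOn.mono (hI0.trans Ioi_subset_Ici_self)
  rw [ae_restrict_iff' hI] at h
  rw [ae_restrict_iff' (hI.image_of_continuousOn_injOn hd.continuousOn hinj)]
  have hnull := addHaar_image_eq_zero_of_differentiableOn_of_addHaar_eq_zero volume
    (hd.mono (s := {x | ¬(x ∈ I → P (l * x ^ m))}) fun x hx => by
      by_contra hxI
      exact hx fun h => absurd h hxI) h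
  refine measure_mono_null ?_ hnull
  intro y hy
  simp only [mem_compl_iff, mem_ofPred_eq, Classical.not_imp] at hy
  obtain ⟨⟨x, hx, rfl⟩, hP⟩ := hy
  exact ⟨x, fun hh => hP (hh hx), rfl⟩

theorem mul_rpow_inverse (hl : 0 < l) (hm : 0 < m) {y : ℝ} (hy : 0 < y) :
    l * (l ^ (-m⁻¹) * y ^ m⁻¹) ^ m = y := by
  rw [Real.mul_rpow (by positivity) (by positivity), ← Real.rpow_mul hl.le,
    Real.rpow_inv_rpow hy.le hm.ne', neg_mul, inv_mul_cancel₀ hm.ne', Real.rpow_neg_one]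
  field_simp

theorem inverse_of_mul_rpow (hl : 0 < l) (hm : 0 < m) {x : ℝ} (hx : 0 < x) :
    l ^ (-m⁻¹) * (l * x ^ m) ^ m⁻¹ = x := by
  rw [Real.mul_rpow hl.le (by positivity), Real.rpow_rpow_inv hx.le hm.ne', ← mul_assoc,
    ← Real.rpow_add hl]
  simp

/-- The inverse map has the same form, with parameters `l ^ (-m⁻¹)` and `m⁻¹`, so the forward
statement applies to it. -/
theorem ae_of_ae_image_mul_rpow (hl : 0 < l) (hm : 0 < m) {I : Set ℝ} (hI : MeasurableSet I)
    (hI0 : I ⊆ Ioi 0) {P : ℝ → Prop}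
    (h : ∀ᵐ y ∂volume.restrict ((fun x : ℝ => l * x ^ m) '' I), P y) :
    ∀ᵐ x ∂volume.restrict I, P (l * x ^ m) := by
  have hc : ContinuousOn (fun x : ℝ => l * x ^ m) I := fun x hx =>
    (hasDerivAt_mul_rpow (hI0 hx)).continuousAt.continuousWithinAt
  have hinj : InjOn (fun x : ℝ => l * x ^ m) I :=
    (strictMonoOn_mul_rpow hl hm).injOn.mono (hI0.trans Ioi_subset_Ici_self)
  have hJ := hI.image_of_continuousOn_injOn hc hinj
  have hJ0 : (fun x : ℝ => l * x ^ m) '' I ⊆ Ioi 0 := by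
    rintro _ ⟨x, hx, rfl⟩
    exact mul_rpow_pos hl (hI0 hx)
  have key := ae_image_mul_rpow (l := l ^ (-m⁻¹)) (m := m⁻¹) (by positivity) (by positivity)
    hJ hJ0 (P := fun x => P (l * x ^ m)) (by
      filter_upwards [h, ae_restrict_mem hJ] with y hy hyJ
      rwa [mul_rpow_inverse hl hm (hJ0 hyJ)])
  rw [image_image, image_congr fun x hx => inverse_of_mul_rpow hl hm (hI0 hx), image_id'] at key
  exact key

theorem essSup_image_mul_rpow (hl : 0 < l) (hm : 0 < m) {I : Set ℝ} (hI : MeasurableSet I)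
    (hI0 : I ⊆ Ioi 0) (F : ℝ → ℝ≥0∞) :
    essSup F (volume.restrict ((fun x : ℝ => l * x ^ m) '' I)) =
      essSup (fun x => F (l * x ^ m)) (volume.restrict I) :=
  le_antisymm
    (essSup_le_of_ae_le _ (ae_image_mul_rpow hl hm hI hI0 (ENNReal.ae_le_essSup _)))
    (essSup_le_of_ae_le _ (ae_of_ae_image_mul_rpow hl hm hI hI0 (ENNReal.ae_le_essSup _)))

/-- For finite `q`, the factor split off is what the Jacobian `l * m * x ^ (m - 1)` cancels after
raising to the power `q`, up to the constant `l ^ (α * q) * m`. -/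
theorem weight_mul_rpow (hl : 0 < l) (q : ℝ≥0∞) (α : ℝ) (a : ℝ → ℝ) {x : ℝ} (hx : 0 < x) :
    weight α q a (l * x ^ m) = ENNReal.ofReal (l ^ (α - (1 / q).toReal) *
      x ^ ((1 - m) * (1 / q).toReal)) * weight (m * α) q (fun x => a (l * x ^ m)) x := by
  rw [weight, weight, ← ENNReal.ofReal_mul (by positivity),
    Real.mul_rpow hl.le (by positivity), ← Real.rpow_mul hx.le]
  have : x ^ (m * (α - (1 / q).toReal)) =
      x ^ ((1 - m) * (1 / q).toReal) * x ^ (m * α - (1 / q).toReal) := by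
    rw [← Real.rpow_add hx]
    ring_nf
  rw [this]
  ring_nf

/-- Substitution `y = l x ^ m` in a weighted `L_q` quasi-norm. -/
theorem normOn_weight_image (hl : 0 < l) (hm : 0 < m) {q : ℝ≥0∞} (hq : 0 < q) {I : Set ℝ}
    (hI : MeasurableSet I) (hI0 : I ⊆ Ioi 0) (α : ℝ) (a : ℝ → ℝ) (F : ℝ → ℝ≥0∞) :
    normOn q ((fun x : ℝ => l * x ^ m) '' I) (fun y => weight α q a y * F y) =
      ENNReal.ofReal (l ^ α * m ^ (1 / q).toReal) *
        normOn q I (fun x => weight (m * α) q (fun x => a (l * x ^ m)) x * F (l * x ^ m)) := by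
  have hinj : InjOn (fun x : ℝ => l * x ^ m) I :=
    (strictMonoOn_mul_rpow hl hm).injOn.mono (hI0.trans Ioi_subset_Ici_self)
  rw [← normOn_const_mul ENNReal.ofReal_ne_top]
  rcases eq_or_ne q ∞ with rfl | hq'
  · rw [normOn_top, essSup_image_mul_rpow hl hm hI hI0, ← normOn_top]
    refine normOn_congr hI fun x hx => ?_
    rw [weight_mul_rpow hl _ _ _ (hI0 hx), mul_assoc]
    simp
  have hp : 0 < q.toReal := ENNReal.toReal_pos hq.ne' hq'
  rw [normOn_eq_lintegral hq.ne' hq', normOn_eq_lintegral hq.ne' hq',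
    lintegral_image_eq_lintegral_abs_deriv_mul hI
      (fun x hx => (hasDerivAt_mul_rpow (hI0 hx)).hasDerivWithinAt) hinj]
  congr 1
  refine setLIntegral_congr_fun hI fun x hx => ?_
  have hx0 : 0 < x := hI0 hx
  rw [weight_mul_rpow hl _ _ _ hx0, mul_assoc, ENNReal.mul_rpow_of_nonneg _ _ hp.le,
    ENNReal.mul_rpow_of_nonneg (ENNReal.ofReal (l ^ α * _)) _ hp.le, ← mul_assoc]
  congr 1
  rw [ENNReal.ofReal_rpow_of_pos (by positivity), ENNReal.ofReal_rpow_of_pos (by positivity),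
    ← ENNReal.ofReal_mul (by positivity), abs_of_pos (by positivity)]
  congr 1
  have hq1 : (1 / q).toReal * q.toReal = 1 := by
    rw [one_div, ENNReal.toReal_inv, inv_mul_cancel₀ hp.ne']
  rw [Real.mul_rpow (by positivity) (by positivity), Real.mul_rpow (by positivity) (by positivity),
    ← Real.rpow_mul hl.le, ← Real.rpow_mul hx0.le, ← Real.rpow_mul hl.le, ← Real.rpow_mul hm.le,
    sub_mul, mul_assoc (1 - m), hq1, mul_one, Real.rpow_one, Real.rpow_sub hl, Real.rpow_one,
    Real.rpow_sub hx0, Real.rpow_sub hx0, Real.rpow_one]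
  field_simp

end ChangeOfVariables

/-! ### The iterated quasi-norm: substitution, triangle inequality, dilations. -/

section IteratedNorm

theorem aemeasurable_weight {a : ℝ → ℝ} (ha : AEMeasurable a (volume.restrict (Ioi 0)))
    (α : ℝ) (q : ℝ≥0∞) {I : Set ℝ} (hI : I ⊆ Ioi 0) :
    AEMeasurable (weight α q a) (volume.restrict I) :=
  (((measurable_id.pow_const _).aemeasurable.mul ha).ennreal_ofReal).mono_measure
    (Measure.restrict_mono hI le_rfl)

theorem weight_pos {a : ℝ → ℝ} (ha : ∀ t, 0 < t → 0 < a t) (α : ℝ) (q : ℝ≥0∞) {t : ℝ}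
    (ht : 0 < t) : 0 < weight α q a t := by
  have := ha t ht
  rw [weight, ENNReal.ofReal_pos]
  positivity

theorem weight_le_of_le {a a' : ℝ → ℝ} {C : ℝ} (hC : 0 ≤ C) {t : ℝ} (ht : 0 < t)
    (h : a t ≤ C * a' t) (α : ℝ) (q : ℝ≥0∞) :
    weight α q a t ≤ ENNReal.ofReal C * weight α q a' t := by
  rw [weight, weight, ← ENNReal.ofReal_mul hC]
  apply ENNReal.ofReal_le_ofReal
  calc t ^ (α - (1 / q).toReal) * a t ≤ t ^ (α - (1 / q).toReal) * (C * a' t) := by gcongr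
    _ = _ := by ring

/-- Monotonicity in the endpoint supplies the measurability needed for Minkowski at the middle
level; antitonicity does the same at the outer level. -/
theorem measurable_normOn_Ioo (q : ℝ≥0∞) (t : ℝ) (F : ℝ → ℝ≥0∞) :
    Measurable fun u => normOn q (Ioo t u) F :=
  Monotone.measurable fun _ _ h => normOn_mono_set (Ioo_subset_Ioo_right h) F

theorem antitone_normOn_Ioi_Ioo (r q : ℝ≥0∞) (W F : ℝ → ℝ≥0∞) :
    Antitone fun t => normOn r (Ioi t) fun u => W u * normOn q (Ioo t u) F := fun t t' h =>
  (normOn_mono_set (Ioi_subset_Ioi h) _).trans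
    (normOn_mono measurableSet_Ioi fun u _ => by
      gcongr
      exact normOn_mono_set (Ioo_subset_Ioo_left h) F)

variable {α : ℝ} {s r q : ℝ≥0∞} {a b c : ℝ → ℝ} {g g' : ℝ → ℝ≥0∞}

theorem iteratedNormLR_mono (h : ∀ v, 0 < v → g v ≤ g' v) :
    iteratedNormLR α s c r b q a g ≤ iteratedNormLR α s c r b q a g' := by
  refine normOn_mono measurableSet_Ioi fun t ht => mul_le_mul' le_rfl ?_
  refine normOn_mono measurableSet_Ioi fun u _ => mul_le_mul' le_rfl ?_
  exact normOn_mono measurableSet_Ioo fun v hv => mul_le_mul' le_rfl (h v (ht.out.trans hv.1))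

theorem iteratedNormLR_congr (h : ∀ v, 0 < v → g v = g' v) :
    iteratedNormLR α s c r b q a g = iteratedNormLR α s c r b q a g' :=
  le_antisymm (iteratedNormLR_mono fun v hv => (h v hv).le)
    (iteratedNormLR_mono fun v hv => (h v hv).ge)

theorem iteratedNormLR_const_mul {C : ℝ≥0∞} (hC : C ≠ ∞) :
    iteratedNormLR α s c r b q a (fun v => C * g v) = C * iteratedNormLR α s c r b q a g := by
  simp only [iteratedNormLR, mul_left_comm _ C, normOn_const_mul hC]

/-- Replacing the weights by dominating ones. -/
theorem iteratedNormLR_le_of_weights_le {a' b' c' : ℝ → ℝ} {A B C : ℝ}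
    (hA : 0 ≤ A) (hB : 0 ≤ B) (hC : 0 ≤ C)
    (ha : ∀ t, 0 < t → a t ≤ A * a' t) (hb : ∀ t, 0 < t → b t ≤ B * b' t)
    (hc : ∀ t, 0 < t → c t ≤ C * c' t) :
    iteratedNormLR α s c r b q a g ≤
      ENNReal.ofReal (C * B * A) * iteratedNormLR α s c' r b' q a' g := by
  rw [mul_assoc, ENNReal.ofReal_mul hC, ENNReal.ofReal_mul hB, iteratedNormLR, iteratedNormLR,
    ← normOn_const_mul (by finiteness)]
  refine normOn_mono measurableSet_Ioi fun t ht => ?_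
  rw [mul_mul_mul_comm]
  refine mul_le_mul' (weight_le_of_le hC ht (hc t ht) _ _) ?_
  rw [← normOn_const_mul (by finiteness)]
  refine normOn_mono measurableSet_Ioi fun u hu => ?_
  have hu' : 0 < u := ht.out.trans hu
  rw [mul_mul_mul_comm]
  refine mul_le_mul' (weight_le_of_le hB hu' (hb u hu') _ _) ?_
  rw [← normOn_const_mul (by finiteness)]
  refine normOn_mono measurableSet_Ioo fun v hv => ?_
  have hv' : 0 < v := ht.out.trans hv.1
  rw [← mul_assoc]
  exact mul_le_mul' (weight_le_of_le hA hv' (ha v hv') _ _) le_rfl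

/-- The substitution `v = l w ^ m` in the iterated quasi-norm. -/
theorem iteratedNormLR_comp {l m : ℝ} (hl : 0 < l) (hm : 0 < m) (hs : 0 < s) (hr : 0 < r)
    (hq : 0 < q) :
    iteratedNormLR α s c r b q a g =
      ENNReal.ofReal (m ^ (1 / s).toReal * m ^ (1 / r).toReal * (l ^ α * m ^ (1 / q).toReal)) *
        iteratedNormLR (m * α) s (fun x => c (l * x ^ m)) r (fun x => b (l * x ^ m))
          q (fun x => a (l * x ^ m)) (fun x => g (l * x ^ m)) := by
  have h0 : (fun x : ℝ => l * x ^ m) '' Ioi 0 = Ioi 0 := by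
    rw [image_mul_rpow_Ioi hl hm le_rfl, Real.zero_rpow hm.ne', mul_zero]
  rw [ENNReal.ofReal_mul (by positivity), ENNReal.ofReal_mul (by positivity), iteratedNormLR,
    iteratedNormLR]
  conv_lhs => rw [← h0]
  rw [normOn_weight_image hl hm hs measurableSet_Ioi subset_rfl, mul_zero, Real.rpow_zero, one_mul,
    mul_assoc, mul_assoc]
  congr 1
  rw [← normOn_const_mul ENNReal.ofReal_ne_top, ← normOn_const_mul ENNReal.ofReal_ne_top]
  refine normOn_congr measurableSet_Ioi fun t ht => ?_
  simp only [mul_left_comm _ (weight 0 s _ _)]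
  congr 1
  rw [← image_mul_rpow_Ioi hl hm (le_of_lt ht), normOn_weight_image hl hm hr measurableSet_Ioi
    (Ioi_subset_Ioi (le_of_lt ht)), mul_zero, Real.rpow_zero, one_mul]
  congr 1
  rw [← normOn_const_mul ENNReal.ofReal_ne_top]
  refine normOn_congr measurableSet_Ioi fun u hu => ?_
  have ht' : 0 < t := ht
  have hu' : t < u := hu
  rw [mul_left_comm]
  congr 1
  rw [← image_mul_rpow_Ioo hl hm ht'.le (ht'.trans hu').le, normOn_weight_image hl hm hq
    measurableSet_Ioo fun x hx => ht'.trans hx.1]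

theorem mul_rpow_tsum_rpow_inv {ρ : ℝ} (hρ : 0 < ρ) (w : ℝ≥0∞) (x : ℕ → ℝ≥0∞) :
    w * (∑' j, x j ^ ρ) ^ ρ⁻¹ = (∑' j, (w * x j) ^ ρ) ^ ρ⁻¹ := by
  simp_rw [ENNReal.mul_rpow_of_nonneg _ _ hρ.le, ENNReal.tsum_mul_left]
  rw [ENNReal.mul_rpow_of_nonneg _ _ (by positivity), ENNReal.rpow_rpow_inv hρ.ne']

/-- The `ρ`-triangle inequality for the iterated quasi-norm. -/
theorem iteratedNormLR_rpow_tsum_le {ρ : ℝ} (hρ : 0 < ρ) (hs : ENNReal.ofReal ρ ≤ s)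
    (hr : ENNReal.ofReal ρ ≤ r) (hq : ENNReal.ofReal ρ ≤ q)
    (ha : AEMeasurable a (volume.restrict (Ioi 0))) (hb : AEMeasurable b (volume.restrict (Ioi 0)))
    (hc : AEMeasurable c (volume.restrict (Ioi 0))) {G : ℕ → ℝ → ℝ≥0∞}
    (hG : ∀ j, Measurable (G j)) :
    iteratedNormLR α s c r b q a (fun v => (∑' j, G j v ^ ρ) ^ ρ⁻¹) ≤
      (∑' j, iteratedNormLR α s c r b q a (G j) ^ ρ) ^ ρ⁻¹ := by
  refine le_trans ?_ (normOn_rpow_tsum_le hρ hs fun j => (aemeasurable_weight hc _ _ subset_rfl).mul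
    (antitone_normOn_Ioi_Ioo _ _ _ _).measurable.aemeasurable)
  refine normOn_mono measurableSet_Ioi fun t ht => ?_
  rw [← mul_rpow_tsum_rpow_inv hρ]
  gcongr
  refine le_trans ?_ (normOn_rpow_tsum_le hρ hr fun j =>
    (aemeasurable_weight hb _ _ (Ioi_subset_Ioi (le_of_lt ht))).mul
    (measurable_normOn_Ioo _ _ _).aemeasurable)
  refine normOn_mono measurableSet_Ioi fun u hu => ?_
  rw [← mul_rpow_tsum_rpow_inv hρ]
  gcongr
  refine le_trans ?_ (normOn_rpow_tsum_le hρ hq fun j =>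
    (aemeasurable_weight ha _ _ fun v hv => lt_trans ht hv.1).mul (hG j).aemeasurable)
  exact normOn_mono measurableSet_Ioo fun v hv => (mul_rpow_tsum_rpow_inv hρ _ _).le

theorem normOn_eq_top {I : Set ℝ} (hI : MeasurableSet I) (hI' : volume I ≠ 0) (hq : 0 < q)
    {F : ℝ → ℝ≥0∞} (hF : ∀ x ∈ I, F x = ∞) : normOn q I F = ∞ := by
  rw [normOn_congr hI hF, normOn, eLpNorm_const _ hq.ne' (by simpa using hI')]
  simp [ENNReal.top_mul, hI', ENNReal.rpow_eq_zero_iff]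

/-- Serves to show that a finite interpolation quasi-norm forces membership in the sum of the two
spaces. -/
theorem iteratedNormLR_eq_top (ha : ∀ t, 0 < t → 0 < a t) (hb : ∀ t, 0 < t → 0 < b t)
    (hc : ∀ t, 0 < t → 0 < c t) (hs : 0 < s) (hr : 0 < r) (hq : 0 < q)
    (hg : ∀ v, 0 < v → g v = ∞) : iteratedNormLR α s c r b q a g = ∞ := by
  refine normOn_eq_top measurableSet_Ioi (by simp) hs fun t ht => ?_
  have ht' : 0 < t := ht
  rw [normOn_eq_top measurableSet_Ioi (by simp) hr, ENNReal.mul_top (weight_pos hc _ _ ht).ne']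
  intro u hu
  have hu' : t < u := hu
  rw [normOn_eq_top measurableSet_Ioo (by simpa using hu') hq,
    ENNReal.mul_top (weight_pos hb _ _ (ht'.trans hu')).ne']
  intro v hv
  have hv' := ht'.trans hv.1
  rw [hg v hv', ENNReal.mul_top (weight_pos ha _ _ hv').ne']

/-- Compare `t ^ (-ε) * b t` at `t` and `l * t` through its non-increasing equivalent; the
equivalence constant enters twice. -/
theorem IsSlowlyVarying.exists_dilation_le (hb : IsSlowlyVarying b) {ε : ℝ} (hε : 0 < ε) :
    ∃ C : ℝ, 0 < C ∧ ∀ l, 1 ≤ l → ∀ t, 0 < t → b (l * t) ≤ C * l ^ ε * b t := by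
  obtain ⟨g, hg, D, hD, hDg⟩ := hb.decreasing ε hε
  refine ⟨D * D, by positivity, fun l hl t ht => ?_⟩
  have hl0 : 0 < l := zero_lt_one.trans_le hl
  have hlt : 0 < l * t := by positivity
  have h1 : (l * t) ^ (-ε) * b (l * t) ≤ D * (D * (t ^ (-ε) * b t)) :=
    (hDg _ hlt).1.trans (mul_le_mul_of_nonneg_left
      ((hg ht hlt (le_mul_of_one_le_left ht.le hl)).trans (hDg t ht).2) hD.le)
  rw [Real.mul_rpow hl0.le ht.le, Real.rpow_neg hl0.le, Real.rpow_neg ht.le] at h1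
  field_simp at h1
  nlinarith [h1]

/-- Dilation bound for the iterated quasi-norm with slowly varying weights. -/
theorem exists_iteratedNormLR_dilation_le (ha : IsSlowlyVarying a) (hb : IsSlowlyVarying b)
    (hc : IsSlowlyVarying c) (hs : 0 < s) (hr : 0 < r) (hq : 0 < q) {ε : ℝ} (hε : 0 < ε) :
    ∃ C : ℝ, 0 < C ∧ ∀ l : ℝ, 1 ≤ l → ∀ g : ℝ → ℝ≥0∞,
      iteratedNormLR α s c r b q a (fun v => g (l⁻¹ * v)) ≤
        ENNReal.ofReal (C * l ^ (α + ε)) * iteratedNormLR α s c r b q a g := by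
  -- Each of the three weights contributes one third of the loss `l ^ ε`.
  have hε3 : 0 < ε / 3 := by positivity
  obtain ⟨A, hA, ha'⟩ := ha.exists_dilation_le hε3
  obtain ⟨B, hB, hb'⟩ := hb.exists_dilation_le hε3
  obtain ⟨D, hD, hc'⟩ := hc.exists_dilation_le hε3
  refine ⟨D * B * A, by positivity, fun l hl g => ?_⟩
  have hl0 : 0 < l := zero_lt_one.trans_le hl
  rw [iteratedNormLR_comp hl0 one_pos hs hr hq]
  simp only [Real.rpow_one, Real.one_rpow, one_mul, mul_one, inv_mul_cancel_left₀ hl0.ne']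
  refine (mul_le_mul_right (iteratedNormLR_le_of_weights_le (by positivity) (by positivity)
    (by positivity) (ha' l hl) (hb' l hl) (hc' l hl)) _).trans (le_of_eq ?_)
  rw [← mul_assoc, ← ENNReal.ofReal_mul (by positivity)]
  congr 2
  have : l ^ (α + ε) = l ^ α * (l ^ (ε / 3) * l ^ (ε / 3) * l ^ (ε / 3)) := by
    rw [← Real.rpow_add hl0, ← Real.rpow_add hl0, ← Real.rpow_add hl0]
    ring_nf
  rw [this]
  ring

end IteratedNorm

/-! ### The non-increasing rearrangement. -/

section Rearrangement

variable {Ω 𝕜 : Type*} [MeasurableSpace Ω] [RCLike 𝕜] {μ : Measure Ω}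

theorem antitone_rearrangement (f : Ω →ₘ[μ] 𝕜) : Antitone (rearrangement f) := fun _ _ h =>
  sInf_le_sInf fun _ hl => le_trans hl (ENNReal.ofReal_le_ofReal h)

/-- The infimum is attained: the set is the increasing union of superlevel sets along levels
decreasing to it, and measure is continuous from below. -/
theorem measure_rearrangement_lt_le (f : Ω →ₘ[μ] 𝕜) (t : ℝ) :
    μ {x | rearrangement f t < ‖f x‖ₑ} ≤ ENNReal.ofReal t := by
  set S : Set ℝ≥0∞ := {l : ℝ≥0∞ | μ {x | l < ‖f x‖ₑ} ≤ ENNReal.ofReal t} with hS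
  have hne : S.Nonempty := ⟨∞, by simp [hS]⟩
  obtain ⟨u, hu, hlim, huS⟩ := exists_seq_tendsto_sInf hne (OrderBot.bddBelow S)
  have hunion : {x | rearrangement f t < ‖f x‖ₑ} ⊆ ⋃ n, {x | u n < ‖f x‖ₑ} := by
    intro x hx
    obtain ⟨n, hn⟩ := (hlim.eventually_lt_const (show sInf S < ‖f x‖ₑ from hx)).exists
    exact mem_iUnion.2 ⟨n, hn⟩
  refine (measure_mono hunion).trans ?_
  rw [Monotone.measure_iUnion]
  · exact iSup_le huS
  · intro m n h x hx
    exact (hu h).trans_lt hx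

theorem rearrangement_le {f : Ω →ₘ[μ] 𝕜} {t : ℝ} {l : ℝ≥0∞}
    (h : μ {x | l < ‖f x‖ₑ} ≤ ENNReal.ofReal t) : rearrangement f t ≤ l := sInf_le h

theorem rearrangement_add_le (g h : Ω →ₘ[μ] 𝕜) (t : ℝ) :
    rearrangement (g + h) t ≤ rearrangement g t + eLpNorm h ∞ μ := by
  refine rearrangement_le (le_trans (measure_mono_ae ?_) (measure_rearrangement_lt_le g t))
  filter_upwards [AEEqFun.coeFn_add g h, enorm_ae_le_eLpNormEssSup h μ] with x hx hx' hlt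
  have hlt' : rearrangement g t + eLpNorm h ∞ μ < ‖(g + h) x‖ₑ := hlt
  rw [hx, eLpNorm_exponent_top] at hlt'
  have h2 := hlt'.trans_le ((enorm_add_le _ _).trans (add_le_add_right hx' _))
  exact lt_of_add_lt_add_right h2

/-- Chebyshev's inequality at level `N / t ^ (1 / κ)`; `N = 0` and `N = ∞` are separated so that `N
^ κ` can be cancelled. -/
theorem rpow_mul_rearrangement_le {κ : ℝ} (hκ : 0 < κ) (f : Ω →ₘ[μ] 𝕜) {t : ℝ} (ht : 0 < t) :
    ENNReal.ofReal (t ^ (1 / κ)) * rearrangement f t ≤ eLpNorm f (ENNReal.ofReal κ) μ := by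
  have h0 : ENNReal.ofReal κ ≠ 0 := by simpa using hκ
  have hT0 : ENNReal.ofReal (t ^ (1 / κ)) ≠ 0 := by
    rw [Ne, ENNReal.ofReal_eq_zero, not_le]; positivity
  rw [mul_comm, ← ENNReal.le_div_iff_mul_le (Or.inl hT0) (Or.inl ENNReal.ofReal_ne_top)]
  set N := eLpNorm f (ENNReal.ofReal κ) μ with hN
  apply rearrangement_le
  rcases eq_or_ne N 0 with hN0 | hN0
  · have hf : f =ᵐ[μ] 0 := (eLpNorm_eq_zero_iff f.aestronglyMeasurable h0).1 hN0
    rw [hN0, ENNReal.zero_div]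
    refine le_of_eq_of_le (measure_eq_zero_iff_ae_notMem.2 ?_) zero_le
    filter_upwards [hf] with x hx
    simp [hx]
  rcases eq_or_ne N ∞ with hN1 | hN1
  · simp [hN1, ENNReal.top_div]
  have hch := mul_meas_ge_le_pow_eLpNorm' μ h0 ENNReal.ofReal_ne_top f.aestronglyMeasurable
    (N / ENNReal.ofReal (t ^ (1 / κ)))
  rw [ENNReal.toReal_ofReal hκ.le, ENNReal.div_rpow_of_nonneg _ _ hκ.le, ← hN,
    ENNReal.ofReal_rpow_of_pos (by positivity), ← Real.rpow_mul ht.le, one_div_mul_cancel hκ.ne',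
    Real.rpow_one] at hch
  refine (measure_mono (ofPred_subset_ofPred.2 fun x => le_of_lt)).trans ?_
  have hNκ0 : N ^ κ ≠ 0 := by simp [hN0, hN1, ENNReal.rpow_eq_zero_iff]
  have hNκ1 : N ^ κ ≠ ∞ := by simp [hN0, hN1]
  rw [ENNReal.div_eq_inv_mul, mul_assoc,
    ENNReal.inv_mul_le_iff (by simpa using ht) ENNReal.ofReal_ne_top, mul_comm] at hch
  exact (ENNReal.mul_le_mul_iff_left hNκ0 hNκ1).1 hch

end Rearrangement

/-! ### Two-sided estimates of the `K`-functional. -/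

namespace FunctionSpace

variable {Ω 𝕜 : Type*} [MeasurableSpace Ω] [RCLike 𝕜] {μ : Measure Ω}

theorem weakLebesgue_qnorm_le {κ : ℝ} (hκ : 0 < κ) (f : Ω →ₘ[μ] 𝕜) :
    (weakLebesgue μ 𝕜 κ).qnorm f ≤ (lebesgue μ 𝕜 (ENNReal.ofReal κ)).qnorm f :=
  iSup₂_le fun _ ht => rpow_mul_rearrangement_le hκ f ht

theorem lebesgue_carrier_subset {κ : ℝ} (hκ : 0 < κ) :
    (lebesgue μ 𝕜 (ENNReal.ofReal κ)).carrier ⊆ (weakLebesgue μ 𝕜 κ).carrier := fun f hf =>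
  (weakLebesgue_qnorm_le hκ f).trans_lt hf

theorem kFunctional_mono_left {X X' Y : FunctionSpace μ 𝕜} (h : X'.carrier ⊆ X.carrier)
    (h' : ∀ f, X.qnorm f ≤ X'.qnorm f) (t : ℝ) (f : Ω →ₘ[μ] 𝕜) :
    kFunctional X Y t f ≤ kFunctional X' Y t f := by
  refine le_iInf₂ fun g hg => le_iInf₂ fun k hk => le_iInf fun hf => ?_
  exact (iInf₂_le_of_le g (h hg) (iInf₂_le_of_le k hk (iInf_le _ hf))).trans
    (add_le_add_left (h' g) _)

/-- For `f = g + k`, `f^*` exceeds `g^*` by at most the sup norm of `k`, and `v = (v ^ κ) ^ (1 / κ)`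
matches the weak quasi-norm of `g` at the point `v ^ κ`. -/
theorem mul_rearrangement_le_kFunctional {κ : ℝ} (hκ : 0 < κ) (f : Ω →ₘ[μ] 𝕜) {v : ℝ}
    (hv : 0 < v) :
    ENNReal.ofReal v * rearrangement f (v ^ κ) ≤
      kFunctional (weakLebesgue μ 𝕜 κ) (lebesgue μ 𝕜 ∞) v f := by
  refine le_iInf₂ fun g _ => le_iInf₂ fun k _ => le_iInf fun hf => ?_
  subst hf
  refine (mul_le_mul_right (rearrangement_add_le g k _) _).trans ?_
  rw [mul_add]
  refine add_le_add_left ?_ _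
  have hvκ : 0 < v ^ κ := by positivity
  have h : ENNReal.ofReal ((v ^ κ) ^ (1 / κ)) * rearrangement g (v ^ κ) ≤
      (weakLebesgue μ 𝕜 κ).qnorm g :=
    le_iSup₂ (f := fun (t : ℝ) (_ : 0 < t) =>
      ENNReal.ofReal (t ^ (1 / κ)) * rearrangement g t) (v ^ κ) hvκ
  rwa [one_div, Real.rpow_rpow_inv hv.le hκ.ne'] at h

theorem mem_sumSet_of_kFunctional_lt_top {X Y : FunctionSpace μ 𝕜} {t : ℝ} {f : Ω →ₘ[μ] 𝕜}
    (h : kFunctional X Y t f < ∞) : f ∈ sumSet X Y := by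
  by_contra hf
  refine h.ne ?_
  simp only [kFunctional, iInf_eq_top]
  exact fun g hg k hk hgk => absurd ⟨g, hg, k, hk, hgk⟩ hf

/-- Truncation estimate for the part of `f` above the height `rearrangement f (v ^ κ)`. -/
theorem lintegral_indicator_rearrangement_le {κ : ℝ} (hκ : 0 < κ) (f : Ω →ₘ[μ] 𝕜) {v : ℝ}
    (hv : 0 < v) :
    ∫⁻ x in {x | rearrangement f (v ^ κ) < ‖f x‖ₑ}, ‖f x‖ₑ ^ κ ∂μ ≤
      ENNReal.ofReal 2 ^ κ * ∑' j : ℕ, (ENNReal.ofReal (2⁻¹ ^ j * v) *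
        rearrangement f ((2⁻¹ ^ j * v) ^ κ)) ^ κ := by
  set w : ℕ → ℝ := fun j => 2⁻¹ ^ j * v with hw
  have hw0 (j : ℕ) : 0 < w j := by positivity
  set L : ℕ → ℝ≥0∞ := fun j => rearrangement f (w j ^ κ) with hL
  set S : ℕ → Set Ω := fun j => {x | L j < ‖f x‖ₑ} with hS
  have hSm (j : ℕ) : MeasurableSet (S j) :=
    measurableSet_lt measurable_const f.measurable.enorm
  have hμS (j : ℕ) : μ (S j) ≤ ENNReal.ofReal (w j) ^ κ := by
    rw [ENNReal.ofReal_rpow_of_pos (hw0 j)]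
    exact measure_rearrangement_lt_le f _
  have hwlim : Filter.Tendsto (fun j => ENNReal.ofReal (w j) ^ κ) Filter.atTop (nhds 0) := by
    have h1 : Filter.Tendsto w Filter.atTop (nhds 0) := by
      simpa [hw] using (tendsto_pow_atTop_nhds_zero_of_lt_one (r := (2⁻¹ : ℝ)) (by norm_num)
        (by norm_num)).mul_const v
    have h2 := (ENNReal.tendsto_ofReal h1).ennrpow_const κ
    simpa [hκ] using h2
  -- Almost every point of `S 0` therefore has a last `k` before first leaving the `S j`, where `‖f
  -- x‖ₑ ≤ L (k + 1)`.
  have hnull : μ (⋂ j, S j) = 0 := by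
    refine le_antisymm (ge_of_tendsto' hwlim fun j => ?_) zero_le
    exact (measure_mono (iInter_subset _ j)).trans (hμS j)
  have hpt : ∀ᵐ x ∂μ, (S 0).indicator (fun x => ‖f x‖ₑ ^ κ) x ≤
      ∑' j, (S j).indicator (fun _ => L (j + 1) ^ κ) x := by
    filter_upwards [measure_eq_zero_iff_ae_notMem.1 hnull] with x hx
    by_cases hx0 : x ∈ S 0
    · rw [indicator_of_mem hx0]
      classical
      have hex : ∃ j, x ∉ S j := by simpa using hx
      obtain ⟨k, hk⟩ : ∃ k, Nat.find hex = k + 1 :=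
        Nat.exists_eq_succ_of_ne_zero fun h => (h ▸ Nat.find_spec hex) hx0
      have hk1 : x ∉ S (k + 1) := hk ▸ Nat.find_spec hex
      have hk2 : x ∈ S k := not_not.1 (Nat.find_min hex (by omega))
      refine le_trans ?_ (ENNReal.le_tsum k)
      rw [indicator_of_mem hk2]
      exact ENNReal.rpow_le_rpow (not_lt.1 hk1) hκ.le
    · simp [indicator_of_notMem hx0]
  have hS0 : {x | rearrangement f (v ^ κ) < ‖f x‖ₑ} = S 0 := by simp [hS, hL, hw]
  rw [hS0, ← lintegral_indicator (hSm 0)]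
  refine (lintegral_mono_ae hpt).trans ?_
  rw [lintegral_tsum fun j => (measurable_const.indicator (hSm j)).aemeasurable]
  -- The factor `2` comes from `w j = 2 * w (j + 1)`, which aligns the measure of `S j` with the
  -- level `L (j + 1)`.
  have hterm (j : ℕ) : ∫⁻ x, (S j).indicator (fun _ => L (j + 1) ^ κ) x ∂μ ≤
      ENNReal.ofReal 2 ^ κ * (ENNReal.ofReal (w (j + 1)) * L (j + 1)) ^ κ := by
    rw [lintegral_indicator_const (hSm j), ← ENNReal.mul_rpow_of_nonneg _ _ hκ.le, ← mul_assoc,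
      ← ENNReal.ofReal_mul zero_le_two, show 2 * w (j + 1) = w j by simp only [hw]; ring,
      ENNReal.mul_rpow_of_nonneg _ _ hκ.le, mul_comm]
    exact mul_le_mul_left (hμS j) _
  refine (ENNReal.tsum_le_tsum hterm).trans ?_
  rw [ENNReal.tsum_mul_left]
  refine mul_le_mul_right ?_ _
  exact ENNReal.tsum_comp_le_tsum_of_injective (add_left_injective 1)
    (fun j => (ENNReal.ofReal (w j) * L j) ^ κ)

/-- Cut `f` at height `rearrangement f (v ^ κ)`: the high part costs at most `2 * T`, the low part
at most the `j = 0` term of the sum, hence at most `T`. -/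
theorem kFunctional_lebesgue_le {κ : ℝ} (hκ : 0 < κ) (f : Ω →ₘ[μ] 𝕜) {v : ℝ} (hv : 0 < v) :
    kFunctional (lebesgue μ 𝕜 (ENNReal.ofReal κ)) (lebesgue μ 𝕜 ∞) v f ≤
      3 * (∑' j : ℕ, (ENNReal.ofReal (2⁻¹ ^ j * v) *
        rearrangement f ((2⁻¹ ^ j * v) ^ κ)) ^ κ) ^ κ⁻¹ := by
  set T := (∑' j : ℕ, (ENNReal.ofReal (2⁻¹ ^ j * v) *
        rearrangement f ((2⁻¹ ^ j * v) ^ κ)) ^ κ) ^ κ⁻¹ with hT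
  rcases eq_or_ne T ∞ with hT1 | hT1
  · simp [hT1]
  have h0 : ENNReal.ofReal κ ≠ 0 := by simpa using hκ
  set S : Set Ω := {x | rearrangement f (v ^ κ) < ‖f x‖ₑ} with hS
  have hSm : MeasurableSet S := measurableSet_lt measurable_const f.measurable.enorm
  have hfm := f.aestronglyMeasurable
  set g : Ω →ₘ[μ] 𝕜 := AEEqFun.mk (S.indicator f) (hfm.indicator hSm)
  set k : Ω →ₘ[μ] 𝕜 := AEEqFun.mk (Sᶜ.indicator f) (hfm.indicator hSm.compl)
  have hgk : f = g + k := by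
    refine AEEqFun.ext ?_
    filter_upwards [AEEqFun.coeFn_add g k, AEEqFun.coeFn_mk (S.indicator f) (hfm.indicator hSm),
      AEEqFun.coeFn_mk (Sᶜ.indicator f) (hfm.indicator hSm.compl)] with x h1 h2 h3
    rw [h1, Pi.add_apply, h2, h3, ← Pi.add_apply, indicator_self_add_compl]
  have hgT : eLpNorm g (ENNReal.ofReal κ) μ ≤ 2 * T := by
    rw [eLpNorm_congr_ae (AEEqFun.coeFn_mk _ _),
      eLpNorm_indicator_eq_eLpNorm_restrict hSm,
      eLpNorm_eq_lintegral_rpow_enorm_toReal h0 ENNReal.ofReal_ne_top,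
      ENNReal.toReal_ofReal hκ.le, one_div, ENNReal.rpow_inv_le_iff hκ,
      ENNReal.mul_rpow_of_nonneg _ _ hκ.le, hT, ENNReal.rpow_inv_rpow hκ.ne']
    simpa using lintegral_indicator_rearrangement_le hκ f hv
  have hle : ENNReal.ofReal v * rearrangement f (v ^ κ) ≤ T := by
    rw [hT, ENNReal.le_rpow_inv_iff hκ]
    simpa using ENNReal.le_tsum (f := fun j : ℕ => (ENNReal.ofReal (2⁻¹ ^ j * v) *
      rearrangement f ((2⁻¹ ^ j * v) ^ κ)) ^ κ) 0
  have hk : eLpNorm k ∞ μ ≤ rearrangement f (v ^ κ) := by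
    rw [eLpNorm_congr_ae (AEEqFun.coeFn_mk _ _), eLpNorm_exponent_top]
    refine eLpNormEssSup_le_of_ae_enorm_bound (ae_of_all _ fun x => ?_)
    by_cases hx : x ∈ S
    · simp [hx]
    · simpa [hx] using not_lt.1 hx
  have hvk : ENNReal.ofReal v * eLpNorm k ∞ μ ≤ T := (mul_le_mul_right hk _).trans hle
  -- Finiteness of `T` is what puts both pieces in their spaces and makes the splitting admissible.
  have hkfin : eLpNorm k ∞ μ < ∞ := by
    by_contra hcon
    rw [not_lt_top_iff.1 hcon, ENNReal.mul_top (by simpa using hv)] at hvk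
    exact hT1 (top_le_iff.1 hvk)
  refine (iInf₂_le_of_le g (hgT.trans_lt (by finiteness))
    (iInf₂_le_of_le k hkfin (iInf_le _ hgk))).trans ?_
  refine (add_le_add hgT hvk).trans (le_of_eq ?_)
  ring

end FunctionSpace

/-! ### Summation over dyadic dilations. -/

theorem ENNReal.tsum_rpow_le_rpow_tsum {p : ℝ} (hp : 1 ≤ p) (x : ℕ → ℝ≥0∞) :
    ∑' j, x j ^ p ≤ (∑' j, x j) ^ p := by
  have h (y : ℝ≥0∞) : y ^ p = y * y ^ (p - 1) := by
    conv_lhs => rw [show p = 1 + (p - 1) by ring,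
      ENNReal.rpow_add_of_nonneg _ _ zero_le_one (by linarith), ENNReal.rpow_one]
  rw [h, ← ENNReal.tsum_mul_right]
  refine ENNReal.tsum_le_tsum fun j => ?_
  rw [h]
  exact mul_le_mul' le_rfl (ENNReal.rpow_le_rpow (ENNReal.le_tsum j) (by linarith))

/-- The `ℓ^κ` quasi-norm is dominated by the `ℓ^ρ` quasi-norm for `ρ ≤ κ`. -/
theorem ENNReal.tsum_rpow_rpow_inv_le {ρ κ : ℝ} (hρ : 0 < ρ) (hρκ : ρ ≤ κ) (x : ℕ → ℝ≥0∞) :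
    (∑' j, x j ^ κ) ^ κ⁻¹ ≤ (∑' j, x j ^ ρ) ^ ρ⁻¹ := by
  have hκ : 0 < κ := hρ.trans_le hρκ
  have h := ENNReal.tsum_rpow_le_rpow_tsum ((one_le_div hρ).2 hρκ) fun j => x j ^ ρ
  simp only [← ENNReal.rpow_mul, mul_div_cancel₀ _ hρ.ne'] at h
  rw [ENNReal.rpow_inv_le_iff hκ, ← ENNReal.rpow_mul, inv_mul_eq_div]
  exact h

/-- A single finite exponent `ρ` must serve all three levels of the quasi-norm and the comparison
with `ℓ^κ`. -/
theorem ENNReal.exists_ofReal_le_min {κ : ℝ} (hκ : 0 < κ) {q r s : ℝ≥0∞} (hq : 0 < q)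
    (hr : 0 < r) (hs : 0 < s) :
    ∃ ρ : ℝ, 0 < ρ ∧ ρ ≤ κ ∧ ENNReal.ofReal ρ ≤ q ∧ ENNReal.ofReal ρ ≤ r ∧
      ENNReal.ofReal ρ ≤ s := by
  set m := min (min q r) (min s (ENNReal.ofReal κ)) with hm
  have hκ' : m ≤ ENNReal.ofReal κ := (min_le_right _ _).trans (min_le_right _ _)
  have hm1 : m ≠ ∞ := ne_top_of_le_ne_top ENNReal.ofReal_ne_top hκ'
  have hm0 : 0 < m := lt_min (lt_min hq hr) (lt_min hs (by simpa using hκ))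
  refine ⟨m.toReal, ENNReal.toReal_pos hm0.ne' hm1, ENNReal.toReal_le_of_le_ofReal hκ.le hκ', ?_⟩
  rw [ENNReal.ofReal_toReal hm1]
  exact ⟨(min_le_left _ _).trans (min_le_left _ _), (min_le_left _ _).trans (min_le_right _ _),
    (min_le_right _ _).trans (min_le_left _ _)⟩

theorem exists_tsum_geometric_rpow_le {C x ρ : ℝ} (hC : 0 ≤ C) (hx : 0 ≤ x) (hx1 : x < 1)
    (hρ : 0 < ρ) :
    ∃ D : ℝ, 0 < D ∧ (∑' j : ℕ, ENNReal.ofReal (C * x ^ j) ^ ρ) ^ ρ⁻¹ ≤ ENNReal.ofReal D := by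
  have hterm (j : ℕ) : ENNReal.ofReal (C * x ^ j) ^ ρ =
      ENNReal.ofReal (C ^ ρ * (x ^ ρ) ^ j) := by
    rw [ENNReal.ofReal_rpow_of_nonneg (by positivity) hρ.le,
      Real.mul_rpow hC (by positivity), ← Real.rpow_natCast, ← Real.rpow_mul hx, mul_comm (j : ℝ),
      Real.rpow_mul hx, Real.rpow_natCast]
  have hsum : Summable fun j : ℕ => C ^ ρ * (x ^ ρ) ^ j :=
    (summable_geometric_of_lt_one (by positivity) (Real.rpow_lt_one hx hx1 hρ)).mul_left _
  have hfin : (∑' j : ℕ, ENNReal.ofReal (C * x ^ j) ^ ρ) ^ ρ⁻¹ ≠ ∞ := by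
    simp_rw [hterm]
    exact ENNReal.rpow_ne_top_of_nonneg (by positivity) hsum.tsum_ofReal_ne_top
  refine ⟨((∑' j : ℕ, ENNReal.ofReal (C * x ^ j) ^ ρ) ^ ρ⁻¹).toReal + 1, by positivity, ?_⟩
  rw [ENNReal.le_ofReal_iff_toReal_le hfin (by positivity)]
  linarith

section Hardy

variable {s r q : ℝ≥0∞} {a b c : ℝ → ℝ}

/-- A discrete Hardy inequality for the iterated quasi-norm. -/
theorem exists_iteratedNormLR_dyadic_le {θ κ : ℝ} (hθ : 0 < θ) (hκ : 0 < κ)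
    (hs : 0 < s) (hr : 0 < r) (hq : 0 < q)
    (ha : IsSlowlyVarying a) (hb : IsSlowlyVarying b) (hc : IsSlowlyVarying c) :
    ∃ D : ℝ, 0 < D ∧ ∀ G : ℝ → ℝ≥0∞, Measurable G →
      iteratedNormLR (-θ) s c r b q a (fun v => (∑' j : ℕ, G (2⁻¹ ^ j * v) ^ κ) ^ κ⁻¹) ≤
        ENNReal.ofReal D * iteratedNormLR (-θ) s c r b q a G := by
  obtain ⟨ρ, hρ, hρκ, hρq, hρr, hρs⟩ := ENNReal.exists_ofReal_le_min hκ hq hr hs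
  obtain ⟨C, hC, hdil⟩ := exists_iteratedNormLR_dilation_le (α := -θ) ha hb hc hs hr hq
    (half_pos hθ)
  -- The ratio is `2 ^ (-θ / 2)`: half of the decay `-θ` is spent on the slowly varying weights.
  have hx1 : (2 : ℝ) ^ (-θ + θ / 2) < 1 :=
    Real.rpow_lt_one_of_one_lt_of_neg one_lt_two (by linarith)
  obtain ⟨D, hD, hDle⟩ := exists_tsum_geometric_rpow_le hC.le
    (Real.rpow_nonneg zero_le_two _) hx1 hρ
  refine ⟨D, hD, fun G hG => ?_⟩
  calc iteratedNormLR (-θ) s c r b q a (fun v => (∑' j : ℕ, G (2⁻¹ ^ j * v) ^ κ) ^ κ⁻¹)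
      ≤ iteratedNormLR (-θ) s c r b q a (fun v => (∑' j : ℕ, G (2⁻¹ ^ j * v) ^ ρ) ^ ρ⁻¹) :=
        iteratedNormLR_mono fun v _ => ENNReal.tsum_rpow_rpow_inv_le hρ hρκ _
    _ ≤ (∑' j : ℕ, iteratedNormLR (-θ) s c r b q a (fun v => G (2⁻¹ ^ j * v)) ^ ρ) ^ ρ⁻¹ :=
        iteratedNormLR_rpow_tsum_le hρ hρs hρr hρq ha.measurable hb.measurable hc.measurable
          (G := fun j v => G (2⁻¹ ^ j * v)) fun j => hG.comp (measurable_const_mul _)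
    _ ≤ (∑' j : ℕ, (iteratedNormLR (-θ) s c r b q a G *
          ENNReal.ofReal (C * ((2 : ℝ) ^ (-θ + θ / 2)) ^ j)) ^ ρ) ^ ρ⁻¹ := by
        refine ENNReal.rpow_le_rpow (ENNReal.tsum_le_tsum fun j =>
          ENNReal.rpow_le_rpow ?_ hρ.le) (by positivity)
        have h := hdil (2 ^ j) (one_le_pow₀ one_le_two) G
        rw [← Real.rpow_natCast, ← Real.rpow_mul zero_le_two, mul_comm (j : ℝ),
          Real.rpow_mul zero_le_two, Real.rpow_natCast, Real.rpow_natCast, ← inv_pow] at h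
        rwa [mul_comm]
    _ = iteratedNormLR (-θ) s c r b q a G *
          (∑' j : ℕ, ENNReal.ofReal (C * ((2 : ℝ) ^ (-θ + θ / 2)) ^ j) ^ ρ) ^ ρ⁻¹ :=
        (mul_rpow_tsum_rpow_inv hρ _ _).symm
    _ ≤ _ := by
        rw [mul_comm]
        exact mul_le_mul' hDle le_rfl

end Hardy

/-! ### The cycle of embeddings. -/

namespace FunctionSpace

variable {Ω 𝕜 : Type*} [MeasurableSpace Ω] [RCLike 𝕜] {μ : Measure Ω}
  {s r q : ℝ≥0∞} {a b c : ℝ → ℝ}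

theorem Embeds.trans {X Y Z : FunctionSpace μ 𝕜} (h : X.Embeds Y) (h' : Y.Embeds Z) :
    X.Embeds Z := by
  obtain ⟨hXY, C, hC, hCle⟩ := h
  obtain ⟨hYZ, D, hD, hDle⟩ := h'
  refine ⟨hXY.trans hYZ, D * C, by positivity, fun f hf => ?_⟩
  rw [ENNReal.ofReal_mul hD.le, mul_assoc]
  exact (hDle f (hXY hf)).trans (mul_le_mul' le_rfl (hCle f hf))

theorem interpolationLR_lebesgue_embeds_weakLebesgue {θ κ : ℝ} (hκ : 0 < κ) :
    (interpolationLR (lebesgue μ 𝕜 (ENNReal.ofReal κ)) (lebesgue μ 𝕜 ∞) θ s c r b q a).Embeds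
      (interpolationLR (weakLebesgue μ 𝕜 κ) (lebesgue μ 𝕜 ∞) θ s c r b q a) := by
  have h (f : Ω →ₘ[μ] 𝕜) : (interpolationLR (weakLebesgue μ 𝕜 κ) (lebesgue μ 𝕜 ∞)
      θ s c r b q a).qnorm f ≤ (interpolationLR (lebesgue μ 𝕜 (ENNReal.ofReal κ))
      (lebesgue μ 𝕜 ∞) θ s c r b q a).qnorm f :=
    iteratedNormLR_mono fun v _ =>
      kFunctional_mono_left (lebesgue_carrier_subset hκ) (weakLebesgue_qnorm_le hκ) v f
  refine ⟨fun f hf => ⟨?_, (h f).trans_lt hf.2⟩, 1, one_pos, fun f _ => by simpa using h f⟩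
  obtain ⟨g, hg, k, hk, rfl⟩ := hf.1
  exact ⟨g, lebesgue_carrier_subset hκ hg, k, hk, rfl⟩

theorem weight_mul_ofReal {α : ℝ} {v : ℝ} (hv : 0 < v) (x : ℝ≥0∞) :
    weight α q a v * (ENNReal.ofReal v * x) = weight (1 + α) q a v * x := by
  rw [← mul_assoc, weight, weight, ← ENNReal.ofReal_mul' hv.le, mul_right_comm,
    ← Real.rpow_add_one hv.ne']
  ring_nf

/-- The Lorentz–Karamata quasi-norm, rewritten by the substitution `v = w ^ (1 / κ)`. -/
theorem exists_iteratedNormLR_rearrangement_eq {θ κ : ℝ} (hθ1 : θ ≤ 1) (hκ : 0 < κ) {p : ℝ≥0∞}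
    (hp : p = ENNReal.ofReal κ / ENNReal.ofReal (1 - θ)) (hs : 0 < s) (hr : 0 < r) (hq : 0 < q) :
    ∃ C : ℝ, 0 < C ∧ ∀ f : Ω →ₘ[μ] 𝕜,
      iteratedNormLR (-θ) s c r b q a (fun v => ENNReal.ofReal v * rearrangement f (v ^ κ)) =
        ENNReal.ofReal C *
          (lorentzKaramataLR μ 𝕜 p s (rescale κ c) r (rescale κ b) q (rescale κ a)).qnorm f := by
  -- The identity `1 / p = (1 - θ) / κ` includes `θ = 1`, where `p = ∞`.
  have hpα : (1 / p).toReal = 1 / κ * (1 + -θ) := by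
    rw [hp, one_div, ENNReal.inv_div (Or.inl ENNReal.ofReal_ne_top)
      (Or.inr (by simpa using hκ)), ENNReal.toReal_div, ENNReal.toReal_ofReal hκ.le,
      ENNReal.toReal_ofReal (by linarith)]
    ring
  have hm : 0 < 1 / κ := by positivity
  -- One Jacobian factor per level, with `m = 1 / κ` and `l = 1`.
  refine ⟨(1 / κ) ^ (1 / s).toReal * (1 / κ) ^ (1 / r).toReal *
    (1 ^ (1 + -θ) * (1 / κ) ^ (1 / q).toReal), by positivity, fun f => ?_⟩
  have h1 : iteratedNormLR (-θ) s c r b q a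
      (fun v => ENNReal.ofReal v * rearrangement f (v ^ κ)) =
      iteratedNormLR (1 + -θ) s c r b q a (fun v => rearrangement f (v ^ κ)) := by
    refine normOn_congr measurableSet_Ioi fun t ht => congrArg _ ?_
    refine normOn_congr measurableSet_Ioi fun u _ => congrArg _ ?_
    exact normOn_congr measurableSet_Ioo fun v hv => weight_mul_ofReal (ht.out.trans hv.1) _
  rw [h1, iteratedNormLR_comp one_pos hm hs hr hq]
  congr 1
  simp only [lorentzKaramataLR, ofQNorm, hpα, one_mul]
  refine iteratedNormLR_congr fun v hv => ?_
  rw [one_div, Real.rpow_inv_rpow hv.le hκ.ne']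

theorem interpolationLR_weakLebesgue_embeds_lorentzKaramataLR {θ κ : ℝ} (hθ1 : θ ≤ 1)
    (hκ : 0 < κ) {p : ℝ≥0∞} (hp : p = ENNReal.ofReal κ / ENNReal.ofReal (1 - θ))
    (hs : 0 < s) (hr : 0 < r) (hq : 0 < q) :
    (interpolationLR (weakLebesgue μ 𝕜 κ) (lebesgue μ 𝕜 ∞) θ s c r b q a).Embeds
      (lorentzKaramataLR μ 𝕜 p s (rescale κ c) r (rescale κ b) q (rescale κ a)) := by
  obtain ⟨C, hC, hCeq⟩ := exists_iteratedNormLR_rearrangement_eq (μ := μ) (𝕜 := 𝕜) (a := a)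
    (b := b) (c := c) hθ1 hκ hp hs hr hq
  have h (f : Ω →ₘ[μ] 𝕜) :
      (lorentzKaramataLR μ 𝕜 p s (rescale κ c) r (rescale κ b) q (rescale κ a)).qnorm f ≤
        ENNReal.ofReal C⁻¹ * (interpolationLR (weakLebesgue μ 𝕜 κ) (lebesgue μ 𝕜 ∞)
          θ s c r b q a).qnorm f := by
    have hle := mul_le_mul_right ((hCeq f).symm.trans_le (iteratedNormLR_mono fun v hv =>
      mul_rearrangement_le_kFunctional hκ f hv)) (ENNReal.ofReal C⁻¹)
    rwa [← mul_assoc, ← ENNReal.ofReal_mul (by positivity), inv_mul_cancel₀ hC.ne',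
      ENNReal.ofReal_one, one_mul] at hle
  exact ⟨fun f hf => (h f).trans_lt (ENNReal.mul_lt_top ENNReal.ofReal_lt_top hf.2),
    C⁻¹, by positivity, fun f _ => h f⟩

theorem lorentzKaramataLR_embeds_interpolationLR_lebesgue {θ κ : ℝ} (hθ0 : 0 < θ) (hθ1 : θ ≤ 1)
    (hκ : 0 < κ) {p : ℝ≥0∞} (hp : p = ENNReal.ofReal κ / ENNReal.ofReal (1 - θ))
    (hs : 0 < s) (hr : 0 < r) (hq : 0 < q)
    (ha : IsSlowlyVarying a) (hb : IsSlowlyVarying b) (hc : IsSlowlyVarying c) :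
    (lorentzKaramataLR μ 𝕜 p s (rescale κ c) r (rescale κ b) q (rescale κ a)).Embeds
      (interpolationLR (lebesgue μ 𝕜 (ENNReal.ofReal κ)) (lebesgue μ 𝕜 ∞) θ s c r b q a) := by
  obtain ⟨C, hC, hCeq⟩ := exists_iteratedNormLR_rearrangement_eq (μ := μ) (𝕜 := 𝕜) (a := a)
    (b := b) (c := c) hθ1 hκ hp hs hr hq
  obtain ⟨D, hD, hDle⟩ := exists_iteratedNormLR_dyadic_le hθ0 hκ hs hr hq ha hb hc
  have h (f : Ω →ₘ[μ] 𝕜) :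
      (interpolationLR (lebesgue μ 𝕜 (ENNReal.ofReal κ)) (lebesgue μ 𝕜 ∞)
        θ s c r b q a).qnorm f ≤ ENNReal.ofReal (3 * (D * C)) *
      (lorentzKaramataLR μ 𝕜 p s (rescale κ c) r (rescale κ b) q (rescale κ a)).qnorm f := by
    have hG : Measurable fun v : ℝ => ENNReal.ofReal v * rearrangement f (v ^ κ) :=
      ENNReal.measurable_ofReal.mul
        ((antitone_rearrangement f).measurable.comp (measurable_id.pow_const κ))
    have h1 : (interpolationLR (lebesgue μ 𝕜 (ENNReal.ofReal κ)) (lebesgue μ 𝕜 ∞)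
        θ s c r b q a).qnorm f ≤ _ :=
      iteratedNormLR_mono fun v hv => kFunctional_lebesgue_le hκ f hv
    rw [iteratedNormLR_const_mul (by finiteness)] at h1
    rw [ENNReal.ofReal_mul zero_le_three, ENNReal.ofReal_mul hD.le, mul_assoc, mul_assoc, ← hCeq,
      ENNReal.ofReal_ofNat]
    have h2 := hDle _ hG
    beta_reduce at h2
    exact h1.trans (mul_le_mul_right h2 3)
  refine ⟨fun f hf => ?_, 3 * (D * C), by positivity, fun f _ => h f⟩
  have hfin := (h f).trans_lt (ENNReal.mul_lt_top ENNReal.ofReal_lt_top hf)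
  refine ⟨?_, hfin⟩
  -- Outside the sum of the spaces the `K`-functional is an infimum over no decompositions, hence
  -- `∞` at every `v`.
  by_contra hcon
  refine hfin.ne (iteratedNormLR_eq_top ha.pos hb.pos hc.pos hs hr hq fun v _ => ?_)
  by_contra hv
  exact hcon (mem_sumSet_of_kFunctional_lt_top (lt_top_iff_ne_top.2 hv))

end FunctionSpace

theorem theorem5p6 {Ω : Type*} [MeasurableSpace Ω] (μ : Measure Ω) [SigmaFinite μ]
    (hμ : IsNonatomicMeasure μ) (𝕜 : Type*) [RCLike 𝕜]
    (θ κ : ℝ) (hθ0 : 0 < θ) (hθ1 : θ ≤ 1) (hκ : 0 < κ)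
    (p q r s : ℝ≥0∞) (hp : p = ENNReal.ofReal κ / ENNReal.ofReal (1 - θ))
    (hq : 0 < q) (hr : 0 < r) (hs : 0 < s)
    (a b c : ℝ → ℝ)
    (ha : IsSlowlyVarying a) (hb : IsSlowlyVarying b) (hc : IsSlowlyVarying c)
    (hb1 : normOn r (Ioi 1) (weight 0 r b) < ∞) :
    FunctionSpace.Same
      (FunctionSpace.interpolationLR (FunctionSpace.lebesgue μ 𝕜 (ENNReal.ofReal κ))
        (FunctionSpace.lebesgue μ 𝕜 ∞) θ s c r b q a)
      (FunctionSpace.interpolationLR (FunctionSpace.weakLebesgue μ 𝕜 κ)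
        (FunctionSpace.lebesgue μ 𝕜 ∞) θ s c r b q a) ∧
    FunctionSpace.Same
      (FunctionSpace.interpolationLR (FunctionSpace.weakLebesgue μ 𝕜 κ)
        (FunctionSpace.lebesgue μ 𝕜 ∞) θ s c r b q a)
      (FunctionSpace.lorentzKaramataLR μ 𝕜 p s (rescale κ c) r (rescale κ b) q
        (rescale κ a)) := by
  have h₁ := FunctionSpace.interpolationLR_lebesgue_embeds_weakLebesgue (μ := μ) (𝕜 := 𝕜)
    (θ := θ) (s := s) (r := r) (q := q) (a := a) (b := b) (c := c) hκ
  have h₂ := FunctionSpace.interpolationLR_weakLebesgue_embeds_lorentzKaramataLR (μ := μ) (𝕜 := 𝕜)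
    (a := a) (b := b) (c := c) hθ1 hκ hp hs hr hq
  have h₃ := FunctionSpace.lorentzKaramataLR_embeds_interpolationLR_lebesgue (μ := μ) (𝕜 := 𝕜)
    hθ0 hθ1 hκ hp hs hr hq ha hb hc
  exact ⟨⟨h₁, h₂.trans h₃⟩, ⟨h₂, h₃.trans h₁⟩⟩
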